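/- Let $\mathcal X$ be a finite set and let $X,Y$ be $\mathcal X$-valued random variables with joint p.m.f. $q(x,y)$ and $X=Y$ almost surely. For rates $R,R_1,R_2\ge 0$, an $(n,2^{nR},2^{nR_1},2^{nR_2})$ simulation code consists of random maps $p(m\mid w_1,w_2)$, $p(x^n\mid m,w_1)$, $p(y^n\mid m,w_2)$, where $x^n,y^n\in\mathcal X^n$ and $m$, $w_1$, $w_2$ range over $[1:2^{nR}]$, $[1:2^{nR_1}]$, $[1:2^{nR_2}]$, with $[1:2^{a}]=\{1,\dots,\lfloor 2^{a}\rfloor\}$. With $W_1,W_2$ independent and uniform on $[1:2^{nR_1}]$ and $[1:2^{nR_2}]$, the code induces on $(X^n,Y^n)$ the p.m.f. $$p^{(\mathrm{induced})}(x^n,y^n)=\frac{1}{\lfloor 2^{nR_1}\rfloor\lfloor 2^{nR_2}\rfloor}\sum_{w_1,w_2,m}p(m\mid w_1,w_2)\,p(x^n\mid m,w_1)\,p(y^n\mid m,w_2).$$ The triplet $(R,R_1,R_2)$ is achievable for $q$ if there is a sequence of such codes, $n=1,2,\dots$, for which $$\lim_{n\to\infty}\ \sum_{x^n,y^n}\tfrac12\Big|p^{(\mathrm{induced})}(x^n,y^n)-\prod_{i=1}^n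 q(x_i,y_i)\Big|=0,$$ and the simulation rate region $\mathcal R\subseteq\mathbb R^3$ is the closure of the set of achievable triplets. Then $$\mathcal R=\Big\{(R,R_1,R_2)\in\mathbb R^3:\ R,R_1,R_2\ge 0,\quad R+\min\{R_1,R_2\}\ge H(X),\quad R\ge \tfrac12 H(X)\Big\},$$ where $H(X)=-\sum_{x}\Pr[X=x]\log_2\Pr[X=x]$ is the Shannon entropy in bits (with $0\log_2 0=0$). -/

import Mathlib

namespace CoordSim

noncomputable section

/-- The number of elements of the index set `[1 : 2^{nR}]`, i.e. of the positive integers that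
are at most `2^{nR}`. -/
def numIndices (n : ℕ) (R : ℝ) : ℕ := ⌊(2 : ℝ) ^ ((n : ℝ) * R)⌋₊

/-- A simulation code of block length `n` with `K` messages and with shared randomness uniform on
`K₁` and on `K₂` values: the three random maps `p(m | w₁, w₂)`, `p(xⁿ | m, w₁)` and
`p(yⁿ | m, w₂)`. -/
structure SimulationCode (𝒳 𝒴 : Type*) (n K K₁ K₂ : ℕ) where
  /-- the coordinator's random map `p(m | w₁, w₂)` -/
  encoder : Fin K₁ → Fin K₂ → PMF (Fin K)
  /-- the first processor's random map `p(xⁿ | m, w₁)` -/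
  decoder₁ : Fin K → Fin K₁ → PMF (Fin n → 𝒳)
  /-- the second processor's random map `p(yⁿ | m, w₂)` -/
  decoder₂ : Fin K → Fin K₂ → PMF (Fin n → 𝒴)

namespace SimulationCode

variable {𝒳 𝒴 : Type*} {n K K₁ K₂ : ℕ}

/-- The joint p.m.f. of `(W₁, W₂, M, Xⁿ, Yⁿ)` under a code; `W₁` and `W₂` are independent and
uniform. -/
def joint (c : SimulationCode 𝒳 𝒴 n K K₁ K₂) (w₁ : Fin K₁) (w₂ : Fin K₂) (m : Fin K)
    (x : Fin n → 𝒳) (y : Fin n → 𝒴) : ℝ :=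
  (c.encoder w₁ w₂ m).toReal * (c.decoder₁ m w₁ x).toReal * (c.decoder₂ m w₂ y).toReal /
    ((K₁ : ℝ) * (K₂ : ℝ))

/-- The p.m.f. of the output pair `(Xⁿ, Yⁿ)` induced by a code. -/
def induced (c : SimulationCode 𝒳 𝒴 n K K₁ K₂) (z : (Fin n → 𝒳) × (Fin n → 𝒴)) : ℝ :=
  ∑ w₁ : Fin K₁, ∑ w₂ : Fin K₂, ∑ m : Fin K, c.joint w₁ w₂ m z.1 z.2

end SimulationCode

/-- The `n`-fold product p.m.f. `q⁽ⁿ⁾(xⁿ, yⁿ) = ∏ i, q(x_i, y_i)`. -/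
def iidPmf {𝒳 𝒴 : Type*} (q : PMF (𝒳 × 𝒴)) (n : ℕ) (z : (Fin n → 𝒳) × (Fin n → 𝒴)) : ℝ :=
  ∏ i : Fin n, (q (z.1 i, z.2 i)).toReal

/-- Total variation distance `∑ ½ |p - q|` between two p.m.f.s on a finite set. -/
def tvDist {α : Type*} [Fintype α] (p q : α → ℝ) : ℝ := ∑ a, (1 / 2) * |p a - q a|

/-- The rate triplet `(R, R₁, R₂)` is achievable for `q(x, y)`: rates are nonnegative, and some
sequence of `(n, 2^{nR}, 2^{nR₁}, 2^{nR₂})` simulation codes has induced output distribution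
asymptotically equal, in total variation, to the i.i.d. distribution. -/
def Achievable {𝒳 𝒴 : Type*} [Fintype 𝒳] [Fintype 𝒴] (q : PMF (𝒳 × 𝒴)) (R R₁ R₂ : ℝ) : Prop :=
  0 ≤ R ∧ 0 ≤ R₁ ∧ 0 ≤ R₂ ∧
    ∃ c : (n : ℕ) → SimulationCode 𝒳 𝒴 n (numIndices n R) (numIndices n R₁) (numIndices n R₂),
      Filter.Tendsto (fun n => tvDist (c n).induced (iidPmf q n)) Filter.atTop (nhds 0)

/-- The simulation rate region: the closure in `ℝ³` of the set of achievable rate triplets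
`(R, R₁, R₂)`. -/
def simulationRateRegion {𝒳 𝒴 : Type*} [Fintype 𝒳] [Fintype 𝒴] (q : PMF (𝒳 × 𝒴)) :
    Set (ℝ × ℝ × ℝ) :=
  closure {r | Achievable q r.1 r.2.1 r.2.2}

/-- Shannon entropy `H(X)`, in bits, of a random variable with values in a finite set. -/
def entropy {Ω 𝒳 : Type*} [MeasurableSpace Ω] [Fintype 𝒳] (X : Ω → 𝒳)
    (P : MeasureTheory.Measure Ω) : ℝ :=
  -∑ x, P.real (X ⁻¹' {x}) * Real.logb 2 (P.real (X ⁻¹' {x}))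

end

end CoordSim

/-! Converse. Both outputs must almost always equal one common `x`, while typical `x` have mass at
most `τ ≈ 2^(-nH)`. On the diagonal a code is dominated by `∑ j, u j x * v j x`, with one factor per
processor. From `min a b ≤ √(a b)`, subadditivity of the root and Cauchy–Schwarz, its overlap with
the target on typical sequences is at most `√τ * ∑ j, √(α j)` (`sum_min_le`), and the overlap must
tend to 1. Indexing by messages with `α = 1` gives `√τ * K`, hence `H ≤ 2R`. Indexing by `(m, w₁)`
with `α` its law gives `√(τ * K * K₁)`, hence `H ≤ R + R₁`; exchanging the processors gives the
bound with `R₂`.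

Achievability. Let `k ≈ 2^(nr)` with `r = min(R, R₁, R₂)`. Map the seeds almost uniformly to `a₁,
a₂` in `ZMod k` and send `(a₁ + a₂, e)`, where `e` is fresh with `l ≈ 2^(n(R-r))` values. Each
processor subtracts its own element, so both know `(a₁, a₂, e)`: nearly uniform common randomness of
size about `2^(n(R+r))`. Quantizing it reproduces the typical part of the target when `H < R + r =
min(2R, R + R₁, R + R₂)` (`exists_code_tvDist_le`). Taking the closure gives the boundary. -/

namespace CoordSim

/-! ### Chebyshev's inequality and typical sequences -/

theorem sum_prod_eq_one {𝒳 : Type*} [Fintype 𝒳] {p : 𝒳 → ℝ} (hp : ∑ a, p a = 1) (n : ℕ) :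
    ∑ x : Fin n → 𝒳, ∏ i, p (x i) = 1 := by
  rw [← Fintype.sum_pow, hp, one_pow]

/-- The second moment of a sum of i.i.d. centered variables. -/
theorem sum_prod_mul_sq {𝒳 : Type*} [Fintype 𝒳] {p g : 𝒳 → ℝ} (hp : ∑ a, p a = 1)
    (hg : ∑ a, p a * g a = 0) (n : ℕ) :
    ∑ x : Fin n → 𝒳, (∏ i, p (x i)) * (∑ i, g (x i)) ^ 2 = n * ∑ a, p a * g a ^ 2 := by
  induction n with
  | zero => simp
  | succ n ih =>
    rw [← (Fin.consEquiv fun _ : Fin (n + 1) => 𝒳).sum_comp, Fintype.sum_prod_type]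
    -- The first coordinate is split off; the cross term carries the factor `∑ a, p a * g a = 0`.
    have expand : ∀ (a : 𝒳) (x : Fin n → 𝒳),
        (∏ i, p (Fin.consEquiv (fun _ : Fin (n + 1) => 𝒳) (a, x) i)) *
          (∑ i, g (Fin.consEquiv (fun _ : Fin (n + 1) => 𝒳) (a, x) i)) ^ 2 =
        p a * g a ^ 2 * ∏ i, p (x i) + p a * g a * (2 * ((∏ i, p (x i)) * ∑ i, g (x i))) +
          p a * ((∏ i, p (x i)) * (∑ i, g (x i)) ^ 2) := by
      intro a x
      simp only [Fin.consEquiv_apply, Fin.prod_univ_succ, Fin.sum_univ_succ, Fin.cons_zero,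
        Fin.cons_succ]
      ring
    simp only [expand, Finset.sum_add_distrib, ← Finset.mul_sum, ih, sum_prod_eq_one hp]
    simp only [← Finset.sum_mul, hg, hp]
    push_cast
    ring

/-- Chebyshev's inequality for sums of i.i.d. centered variables. -/
theorem sum_prod_deviation_le {𝒳 : Type*} [Fintype 𝒳] {p g : 𝒳 → ℝ} (hp0 : ∀ a, 0 ≤ p a)
    (hp : ∑ a, p a = 1) (hg : ∑ a, p a * g a = 0) {δ : ℝ} (hδ : 0 < δ) {n : ℕ} (hn : 0 < n)
    (B : Finset (Fin n → 𝒳))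
    (hB : ∀ x ∈ B, (∏ i, p (x i)) ≠ 0 → n * δ ≤ |∑ i, g (x i)|) :
    ∑ x ∈ B, ∏ i, p (x i) ≤ (∑ a, p a * g a ^ 2) / δ ^ 2 * (n : ℝ)⁻¹ := by
  have hn' : (0 : ℝ) < n := by exact_mod_cast hn
  have hpos : 0 < (n * δ) ^ 2 := by positivity
  have key : (n * δ) ^ 2 * ∑ x ∈ B, ∏ i, p (x i) ≤ n * ∑ a, p a * g a ^ 2 := by
    rw [← sum_prod_mul_sq hp hg, Finset.mul_sum]
    calc ∑ x ∈ B, (n * δ) ^ 2 * ∏ i, p (x i)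
        ≤ ∑ x ∈ B, (∏ i, p (x i)) * (∑ i, g (x i)) ^ 2 := by
          refine Finset.sum_le_sum fun x hx => ?_
          by_cases h0 : (∏ i, p (x i)) = 0
          · simp [h0]
          · rw [mul_comm, ← sq_abs (∑ i, g (x i))]
            have h1 : 0 ≤ ∏ i, p (x i) := Finset.prod_nonneg fun i _ => hp0 _
            have h2 := hB x hx h0
            gcongr
      _ ≤ _ := Finset.sum_le_univ_sum_of_nonneg fun x =>
          mul_nonneg (Finset.prod_nonneg fun i _ => hp0 _) (sq_nonneg _)
  rw [← le_div_iff₀' hpos] at key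
  refine key.trans_eq ?_
  field_simp

/-- The entropy, in bits, of a mass function. -/
noncomputable def massEntropy {𝒳 : Type*} [Fintype 𝒳] (p : 𝒳 → ℝ) : ℝ :=
  -∑ a, p a * Real.logb 2 (p a)

/-- Since `Real.logb 2 0 = 0`, the logarithm of a product splits only when no factor vanishes. This
is why the deviation bound above exempts sequences of mass zero. -/
theorem logb_prod_add {𝒳 : Type*} {p : 𝒳 → ℝ} (h : ℝ) {n : ℕ} {x : Fin n → 𝒳}
    (hx : (∏ i, p (x i)) ≠ 0) :
    Real.logb 2 (∏ i, p (x i)) + n * h = ∑ i, (Real.logb 2 (p (x i)) + h) := by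
  rw [Real.logb_prod _ _ fun i hi => Finset.prod_ne_zero_iff.mp hx i hi, Finset.sum_add_distrib]
  simp

theorem sum_mul_logb_add_massEntropy {𝒳 : Type*} [Fintype 𝒳] {p : 𝒳 → ℝ}
    (hp : ∑ a, p a = 1) : ∑ a, p a * (Real.logb 2 (p a) + massEntropy p) = 0 := by
  simp only [mul_add, Finset.sum_add_distrib, ← Finset.sum_mul, hp, massEntropy]
  ring

open Filter Topology in
/-- Sequences that are more likely than `2 ^ (-n (H - δ))` have vanishing probability. -/
theorem tendsto_sum_prod_of_large {𝒳 : Type*} [Fintype 𝒳] {p : 𝒳 → ℝ} (hp0 : ∀ a, 0 ≤ p a)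
    (hp : ∑ a, p a = 1) {δ : ℝ} (hδ : 0 < δ) :
    Tendsto (fun n : ℕ => ∑ x : Fin n → 𝒳 with
      (2 : ℝ) ^ (-(n * (massEntropy p - δ))) < ∏ i, p (x i), ∏ i, p (x i)) atTop (𝓝 0) := by
  refine squeeze_zero' (g := fun n : ℕ => (∑ a, p a *
      (Real.logb 2 (p a) + massEntropy p) ^ 2) / δ ^ 2 * (n : ℝ)⁻¹)
    (Eventually.of_forall fun n => Finset.sum_nonneg fun x _ =>
      Finset.prod_nonneg fun i _ => hp0 _) ?_ ?_
  · filter_upwards [eventually_gt_atTop 0] with n hn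
    refine sum_prod_deviation_le hp0 hp (sum_mul_logb_add_massEntropy hp) hδ hn _ ?_
    intro x hx h0
    rw [← logb_prod_add _ h0]
    have h1 := (Finset.mem_filter.mp hx).2
    have h2 := Real.logb_lt_logb one_lt_two (by positivity) h1
    rw [Real.logb_rpow (by norm_num) (by norm_num)] at h2
    refine le_trans ?_ (le_abs_self _)
    linarith
  · simpa using tendsto_inv_atTop_nhds_zero_nat.const_mul
      ((∑ a, p a * (Real.logb 2 (p a) + massEntropy p) ^ 2) / δ ^ 2)

open Filter Topology in
/-- Sequences that are less likely than `2 ^ (-n (H + δ))` have vanishing probability. -/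
theorem tendsto_sum_prod_of_small {𝒳 : Type*} [Fintype 𝒳] {p : 𝒳 → ℝ} (hp0 : ∀ a, 0 ≤ p a)
    (hp : ∑ a, p a = 1) {δ : ℝ} (hδ : 0 < δ) :
    Tendsto (fun n : ℕ => ∑ x : Fin n → 𝒳 with
      ∏ i, p (x i) < (2 : ℝ) ^ (-(n * (massEntropy p + δ))), ∏ i, p (x i)) atTop (𝓝 0) := by
  refine squeeze_zero' (g := fun n : ℕ => (∑ a, p a *
      (Real.logb 2 (p a) + massEntropy p) ^ 2) / δ ^ 2 * (n : ℝ)⁻¹)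
    (Eventually.of_forall fun n => Finset.sum_nonneg fun x _ =>
      Finset.prod_nonneg fun i _ => hp0 _) ?_ ?_
  · filter_upwards [eventually_gt_atTop 0] with n hn
    refine sum_prod_deviation_le hp0 hp (sum_mul_logb_add_massEntropy hp) hδ hn _ ?_
    intro x hx h0
    rw [← logb_prod_add _ h0]
    have h1 := (Finset.mem_filter.mp hx).2
    have hpos : 0 < ∏ i, p (x i) :=
      lt_of_le_of_ne (Finset.prod_nonneg fun i _ => hp0 _) (Ne.symm h0)
    have h2 := Real.logb_lt_logb one_lt_two hpos h1
    rw [Real.logb_rpow (by norm_num) (by norm_num)] at h2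
    refine le_trans ?_ (neg_le_abs _)
    linarith
  · simpa using tendsto_inv_atTop_nhds_zero_nat.const_mul
      ((∑ a, p a * (Real.logb 2 (p a) + massEntropy p) ^ 2) / δ ^ 2)

/-! ### Sizes of the index sets and elementary limits -/

theorem numIndices_le (n : ℕ) (R : ℝ) : (numIndices n R : ℝ) ≤ 2 ^ (n * R) :=
  Nat.floor_le (by positivity)

theorem one_le_two_rpow_mul (n : ℕ) {R : ℝ} (hR : 0 ≤ R) : (1 : ℝ) ≤ 2 ^ (n * R) :=
  Real.one_le_rpow one_le_two (by positivity)

theorem numIndices_pos (n : ℕ) {R : ℝ} (hR : 0 ≤ R) : 0 < numIndices n R :=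
  Nat.floor_pos.mpr (one_le_two_rpow_mul n hR)

theorem numIndices_mono (n : ℕ) {R R' : ℝ} (h : R ≤ R') : numIndices n R ≤ numIndices n R' :=
  Nat.floor_mono (Real.rpow_le_rpow_of_exponent_le one_le_two (by gcongr))

theorem half_two_rpow_le_numIndices (n : ℕ) {R : ℝ} (hR : 0 ≤ R) :
    (2 : ℝ) ^ (n * R) / 2 ≤ numIndices n R := by
  have h1 : (2 : ℝ) ^ (n * R) < numIndices n R + 1 := Nat.lt_floor_add_one _
  have h2 : (1 : ℝ) ≤ numIndices n R := by exact_mod_cast numIndices_pos n hR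
  linarith

open Filter Topology in
theorem tendsto_two_rpow_mul {a : ℝ} (ha : a < 0) :
    Tendsto (fun n : ℕ => (2 : ℝ) ^ (n * a)) atTop (𝓝 0) := by
  have h : ∀ n : ℕ, (2 : ℝ) ^ (n * a) = ((2 : ℝ) ^ a) ^ n := fun n => by
    rw [mul_comm, Real.rpow_mul_natCast (by norm_num)]
  simp only [h]
  exact tendsto_pow_atTop_nhds_zero_of_lt_one (by positivity)
    (Real.rpow_lt_one_of_one_lt_of_neg one_lt_two ha)

theorem sum_toReal_pmf {α : Type*} [Fintype α] (p : PMF α) : ∑ a, (p a).toReal = 1 := by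
  rw [← ENNReal.toReal_sum fun a _ => p.apply_ne_top a, ← tsum_fintype (L := .unconditional α),
    p.tsum_coe, ENNReal.toReal_one]

/-! ### Converse: overlap bounds on the diagonal -/

theorem sqrt_add_le (x y : ℝ) : √(x + y) ≤ √x + √y := by
  refine Real.sqrt_le_iff.mpr ⟨by positivity, ?_⟩
  have hx : x ≤ √x ^ 2 := Real.sq_sqrt' (x := x) ▸ le_max_left _ _
  have hy : y ≤ √y ^ 2 := Real.sq_sqrt' (x := y) ▸ le_max_left _ _
  have hxy := mul_nonneg (Real.sqrt_nonneg x) (Real.sqrt_nonneg y)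
  linarith [add_sq (√x) (√y)]

/-- A mass function dominated by a sum of products cannot have a large overlap with a mass
function that has only small atoms. -/
theorem sum_min_le {T J : Type*} [Fintype T] [Fintype J] {p q : T → ℝ} {u v : J → T → ℝ}
    {α : J → ℝ} (hu0 : ∀ j x, 0 ≤ u j x) (hv0 : ∀ j x, 0 ≤ v j x) (hu : ∀ j, ∑ x, u j x ≤ 1)
    (hv : ∀ j, ∑ x, v j x ≤ α j) (hp : ∀ x, p x ≤ ∑ j, u j x * v j x) {τ : ℝ} (G : Finset T)
    (hq0 : ∀ x, 0 ≤ q x) (hq : ∀ x ∈ G, q x ≤ τ) :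
    ∑ x ∈ G, min (q x) (p x) ≤ √τ * ∑ j, √(α j) := by
  have pointwise : ∀ x ∈ G, min (q x) (p x) ≤ √τ * ∑ j, √(u j x) * √(v j x) := by
    intro x hx
    have h0 : 0 ≤ ∑ j, u j x * v j x :=
      Finset.sum_nonneg fun j _ => mul_nonneg (hu0 j x) (hv0 j x)
    -- The minimum of two nonnegative numbers is at most their geometric mean.
    have h1 : min (q x) (p x) ≤ √(q x) * √(∑ j, u j x * v j x) := by
      refine (min_le_min_left _ (hp x)).trans ?_
      rw [← Real.sqrt_mul (hq0 x)]
      apply Real.le_sqrt_of_sq_le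
      rw [sq]
      exact mul_le_mul (min_le_left _ _) (min_le_right _ _) (le_min (hq0 x) h0) (hq0 x)
    refine h1.trans (mul_le_mul (Real.sqrt_le_sqrt (hq x hx)) ?_ (Real.sqrt_nonneg _)
      (Real.sqrt_nonneg _))
    simp only [← Real.sqrt_mul (hu0 _ _)]
    exact Finset.le_sum_of_subadditive Real.sqrt Real.sqrt_zero.le
      sqrt_add_le _ _
  calc ∑ x ∈ G, min (q x) (p x)
      ≤ ∑ x ∈ G, √τ * ∑ j, √(u j x) * √(v j x) := Finset.sum_le_sum pointwise
    _ ≤ ∑ x, √τ * ∑ j, √(u j x) * √(v j x) :=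
        Finset.sum_le_univ_sum_of_nonneg fun x => by positivity
    _ = √τ * ∑ j, ∑ x, √(u j x) * √(v j x) := by
        rw [← Finset.mul_sum, Finset.sum_comm]
    _ ≤ √τ * ∑ j, √(α j) := by
        gcongr with j
        refine (Real.sum_sqrt_mul_sqrt_le _ (hu0 j) (hv0 j)).trans ?_
        calc √(∑ x, u j x) * √(∑ x, v j x) ≤ 1 * √(α j) :=
              mul_le_mul (Real.sqrt_le_one.mpr (hu j)) (Real.sqrt_le_sqrt (hv j))
                (Real.sqrt_nonneg _) zero_le_one
          _ = √(α j) := one_mul _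

theorem sum_diag_le {T : Type*} [Fintype T] {f : T × T → ℝ} (hf : ∀ z, 0 ≤ f z) (G : Finset T) :
    ∑ x ∈ G, f (x, x) ≤ ∑ z, f z := by
  rw [Fintype.sum_prod_type]
  calc ∑ x ∈ G, f (x, x) ≤ ∑ x, f (x, x) := Finset.sum_le_univ_sum_of_nonneg fun x => hf _
    _ ≤ ∑ x, ∑ y, f (x, y) := Finset.sum_le_sum fun x _ =>
        Finset.single_le_sum (f := fun y => f (x, y)) (fun y _ => hf _) (Finset.mem_univ x)

/-- Closeness in total variation forces overlap on the diagonal. -/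
theorem sum_sub_two_mul_tvDist_le {T : Type*} [Fintype T] (p q : T × T → ℝ) (G : Finset T) :
    ∑ x ∈ G, q (x, x) - 2 * tvDist p q ≤ ∑ x ∈ G, min (q (x, x)) (p (x, x)) := by
  have h1 := sum_diag_le (f := fun z => |p z - q z|) (fun z => abs_nonneg _) G
  have h2 : 2 * tvDist p q = ∑ z, |p z - q z| := by
    simp only [tvDist, ← Finset.mul_sum]
    ring
  have h3 : ∑ x ∈ G, q (x, x) ≤
      ∑ x ∈ G, (min (q (x, x)) (p (x, x)) + |p (x, x) - q (x, x)|) := by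
    refine Finset.sum_le_sum fun x _ => ?_
    rcases le_total (q (x, x)) (p (x, x)) with h | h
    · rw [min_eq_left h]
      linarith [abs_nonneg (p (x, x) - q (x, x))]
    · rw [min_eq_right h]
      linarith [neg_le_abs (p (x, x) - q (x, x))]
  rw [Finset.sum_add_distrib] at h3
  linarith

/-- Cauchy–Schwarz against the constant 1. Applied to the law of `(M, W₁)`, it yields `√(K * K₁)`
where the trivial bound would give `K * K₁`. -/
theorem sum_sqrt_le {J : Type*} [Fintype J] {α : J → ℝ} (h0 : ∀ j, 0 ≤ α j)
    (h1 : ∑ j, α j ≤ 1) : ∑ j, √(α j) ≤ √(Fintype.card J) := by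
  apply Real.le_sqrt_of_sq_le
  refine sq_sum_le_card_mul_sum_sq.trans ?_
  simp only [Real.sq_sqrt (h0 _), Finset.card_univ]
  exact mul_le_of_le_one_right (Nat.cast_nonneg _) h1

namespace SimulationCode

variable {𝒳 𝒴 : Type*} {n K K₁ K₂ : ℕ}

/-- The code in which the two processors have exchanged their roles. -/
def swap (c : SimulationCode 𝒳 𝒴 n K K₁ K₂) : SimulationCode 𝒴 𝒳 n K K₂ K₁ where
  encoder w₂ w₁ := c.encoder w₁ w₂
  decoder₁ := c.decoder₂
  decoder₂ := c.decoder₁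

theorem induced_swap (c : SimulationCode 𝒳 𝒴 n K K₁ K₂) (x : Fin n → 𝒳) (y : Fin n → 𝒴) :
    c.swap.induced (y, x) = c.induced (x, y) := by
  simp only [induced, joint, swap]
  rw [Finset.sum_comm]
  refine Finset.sum_congr rfl fun _ _ => Finset.sum_congr rfl fun _ _ =>
    Finset.sum_congr rfl fun _ _ => ?_
  ring

/-- The number of messages bounds the overlap of the diagonal part of the output of a code with
a mass function that has only small atoms. -/
theorem sum_min_induced_le_card_message [Fintype 𝒳] (c : SimulationCode 𝒳 𝒳 n K K₁ K₂)
    {q : (Fin n → 𝒳) → ℝ} {τ : ℝ} (G : Finset (Fin n → 𝒳)) (hq0 : ∀ x, 0 ≤ q x)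
    (hq : ∀ x ∈ G, q x ≤ τ) :
    ∑ x ∈ G, min (q x) (c.induced (x, x)) ≤ √τ * K := by
  have h := sum_min_le (p := fun x => c.induced (x, x)) (q := q) (τ := τ) (α := fun _ => 1)
    (u := fun (m : Fin K) x => ∑ w₁ : Fin K₁, (c.decoder₁ m w₁ x).toReal / K₁)
    (v := fun (m : Fin K) x => ∑ w₂ : Fin K₂, (c.decoder₂ m w₂ x).toReal / K₂)
    (fun m x => by positivity) (fun m x => by positivity) ?_ ?_ ?_ G hq0 hq
  · simpa using h
  · intro m
    rw [Finset.sum_comm]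
    simp only [← Finset.sum_div, sum_toReal_pmf]
    -- Only `≤ 1` is claimed: for `K₁ = 0` the quotient is 0.
    simpa using div_self_le_one (K₁ : ℝ)
  · intro m
    rw [Finset.sum_comm]
    simp only [← Finset.sum_div, sum_toReal_pmf]
    simpa using div_self_le_one (K₂ : ℝ)
  · intro x
    simp only [induced, joint, Finset.sum_mul_sum]
    rw [Finset.sum_comm (s := (Finset.univ : Finset (Fin K)))]
    refine Finset.sum_le_sum fun w₁ _ => ?_
    rw [Finset.sum_comm (s := (Finset.univ : Finset (Fin K)))]
    refine Finset.sum_le_sum fun w₂ _ => Finset.sum_le_sum fun m _ => ?_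
    rw [mul_assoc, mul_div_assoc, div_mul_div_comm]
    -- Bounding the encoder probability by 1 decouples `w₁` from `w₂`, so each message contributes a
    -- product.
    refine mul_le_of_le_one_left (by positivity) ?_
    exact ENNReal.toReal_le_of_le_ofReal zero_le_one (by simpa using PMF.coe_le_one _ _)

/-- The number of pairs of a message and a value of `W₁` bounds the overlap of the diagonal part
of the output of a code with a mass function that has only small atoms. -/
theorem sum_min_induced_le_card_message_mul [Fintype 𝒳] (c : SimulationCode 𝒳 𝒳 n K K₁ K₂)
    {q : (Fin n → 𝒳) → ℝ} {τ : ℝ} (G : Finset (Fin n → 𝒳)) (hq0 : ∀ x, 0 ≤ q x)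
    (hq : ∀ x ∈ G, q x ≤ τ) :
    ∑ x ∈ G, min (q x) (c.induced (x, x)) ≤ √τ * √(K * K₁) := by
  -- Here `α` is the law of `(M, W₁)`, and `v j` is the joint mass of `j` with the second output.
  have h := sum_min_le (J := Fin K × Fin K₁) (p := fun x => c.induced (x, x)) (q := q) (τ := τ)
    (α := fun j => ∑ w₂ : Fin K₂, (c.encoder j.2 w₂ j.1).toReal / (K₁ * K₂))
    (u := fun j x => (c.decoder₁ j.1 j.2 x).toReal)
    (v := fun j x => ∑ w₂ : Fin K₂, (c.encoder j.2 w₂ j.1).toReal / (K₁ * K₂) *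
      (c.decoder₂ j.1 w₂ x).toReal)
    (fun j x => by positivity) (fun j x => by positivity) (fun j => (sum_toReal_pmf _).le)
    ?_ ?_ G hq0 hq
  · refine h.trans (mul_le_mul_of_nonneg_left ?_ (Real.sqrt_nonneg _))
    refine (sum_sqrt_le (fun j => by positivity) ?_).trans (by simp)
    rw [Fintype.sum_prod_type_right]
    have : ∀ w₁ : Fin K₁, ∑ m : Fin K, ∑ w₂ : Fin K₂,
        (c.encoder w₁ w₂ m).toReal / ((K₁ : ℝ) * K₂) = ∑ w₂ : Fin K₂, 1 / ((K₁ : ℝ) * K₂) := by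
      intro w₁
      rw [Finset.sum_comm]
      simp only [← Finset.sum_div, sum_toReal_pmf]
    simp only [this, Finset.sum_const, Finset.card_univ, Fintype.card_fin, nsmul_eq_mul]
    rw [← mul_assoc, mul_one_div]
    exact div_self_le_one _
  · intro j
    rw [Finset.sum_comm]
    simp only [← Finset.mul_sum, sum_toReal_pmf, mul_one, le_refl]
  · intro x
    rw [Fintype.sum_prod_type_right]
    simp only [induced, joint]
    refine Finset.sum_le_sum fun w₁ _ => ?_
    rw [Finset.sum_comm]
    refine Finset.sum_le_sum fun m _ => ?_
    rw [Finset.mul_sum]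
    refine Finset.sum_le_sum fun w₂ _ => le_of_eq ?_
    ring

end SimulationCode

open Filter Topology in
/-- If the i.i.d. sequences with small atoms have, up to a vanishing error, total mass at most
`√(τ 2 ^ (n a))`, where `τ` bounds their atoms, then the entropy is at most `a`. -/
theorem massEntropy_le_of_sum_sub_le {𝒳 : Type*} [Fintype 𝒳] {p : 𝒳 → ℝ} (hp0 : ∀ a, 0 ≤ p a)
    (hp : ∑ a, p a = 1) {t : ℕ → ℝ} (ht : Tendsto t atTop (𝓝 0)) {a : ℝ}
    (h : ∀ (n : ℕ) (τ : ℝ) (G : Finset (Fin n → 𝒳)), (∀ x ∈ G, ∏ i, p (x i) ≤ τ) →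
      ∑ x ∈ G, ∏ i, p (x i) - 2 * t n ≤ √τ * √(2 ^ (n * a))) :
    massEntropy p ≤ a := by
  by_contra! hlt
  -- With half the gap as `δ`, the exponent `-n(H - δ) + na` equals `-nδ`.
  set δ := (massEntropy p - a) / 2 with hδ
  have hδ0 : 0 < δ := by linarith
  have key : ∀ n : ℕ, 1 - (∑ x : Fin n → 𝒳 with
      (2 : ℝ) ^ (-(n * (massEntropy p - δ))) < ∏ i, p (x i), ∏ i, p (x i)) - 2 * t n ≤
      √(2 ^ (n * (-δ))) := by
    intro n
    have h1 := h n (2 ^ (-(n * (massEntropy p - δ)))) (Finset.univ.filter fun x =>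
      ¬ (2 : ℝ) ^ (-(n * (massEntropy p - δ))) < ∏ i, p (x i))
      fun x hx => not_lt.mp (Finset.mem_filter.mp hx).2
    have h2 := Finset.sum_filter_add_sum_filter_not Finset.univ
      (fun x : Fin n → 𝒳 => (2 : ℝ) ^ (-(n * (massEntropy p - δ))) < ∏ i, p (x i))
      (fun x => ∏ i, p (x i))
    rw [sum_prod_eq_one hp] at h2
    rw [← Real.sqrt_mul (by positivity), ← Real.rpow_add two_pos,
      show -(n * (massEntropy p - δ)) + n * a = n * (-δ) by rw [hδ]; ring] at h1
    linarith
  have lim1 := ((tendsto_sum_prod_of_large hp0 hp hδ0).const_sub 1).sub (ht.const_mul 2)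
  have lim2 := (tendsto_two_rpow_mul (neg_lt_zero.mpr hδ0)).sqrt
  have := le_of_tendsto_of_tendsto' lim1 lim2 key
  -- The limits read `1 ≤ 0`.
  norm_num at this

-- The three overlap bounds are `√(τ * 2^(n a))` with `a = 2R`, `R + R₁` and `R + R₂`.
open Filter Topology in
theorem Achievable.massEntropy_le {𝒳 : Type*} [Fintype 𝒳] {q : PMF (𝒳 × 𝒳)} {p : 𝒳 → ℝ}
    (hpq : ∀ a, (q (a, a)).toReal = p a) (hp : ∑ a, p a = 1) {R R₁ R₂ : ℝ}
    (h : Achievable q R R₁ R₂) :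
    massEntropy p ≤ 2 * R ∧ massEntropy p ≤ R + R₁ ∧ massEntropy p ≤ R + R₂ := by
  obtain ⟨hR, hR₁, hR₂, c, hc⟩ := h
  have hp0 : ∀ a, 0 ≤ p a := fun a => hpq a ▸ ENNReal.toReal_nonneg
  have hprod : ∀ {n : ℕ} (x : Fin n → 𝒳), 0 ≤ ∏ i, p (x i) := fun x =>
    Finset.prod_nonneg fun i _ => hp0 _
  have overlap : ∀ (n : ℕ) (G : Finset (Fin n → 𝒳)),
      ∑ x ∈ G, ∏ i, p (x i) - 2 * tvDist (c n).induced (iidPmf q n) ≤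
      ∑ x ∈ G, min (∏ i, p (x i)) ((c n).induced (x, x)) := fun n G => by
    simpa [iidPmf, hpq] using sum_sub_two_mul_tvDist_le (c n).induced (iidPmf q n) G
  refine ⟨massEntropy_le_of_sum_sub_le hp0 hp hc fun n τ G hG => ?_,
    massEntropy_le_of_sum_sub_le hp0 hp hc fun n τ G hG => ?_,
    massEntropy_le_of_sum_sub_le hp0 hp hc fun n τ G hG => ?_⟩
  · refine (overlap n G).trans (((c n).sum_min_induced_le_card_message G hprod hG).trans ?_)
    gcongr
    refine (numIndices_le n R).trans (Real.le_sqrt_of_sq_le (le_of_eq ?_))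
    rw [sq, ← Real.rpow_add two_pos]
    ring_nf
  · refine (overlap n G).trans (((c n).sum_min_induced_le_card_message_mul G hprod hG).trans ?_)
    rw [mul_add, Real.rpow_add two_pos]
    gcongr <;> exact numIndices_le _ _
  · have overlap_swap := overlap n G
    simp only [← (c n).induced_swap] at overlap_swap
    refine overlap_swap.trans
      (((c n).swap.sum_min_induced_le_card_message_mul G hprod hG).trans ?_)
    rw [mul_add, Real.rpow_add two_pos]
    gcongr <;> exact numIndices_le _ _

/-! ### Achievability: quantizing common randomness -/

/-- Weights at most `η` can be collected to any attainable total, up to an error `η`. -/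
theorem exists_subset_sum_mem_Icc {ι : Type*} {u : ι → ℝ} {η : ℝ} (hη0 : 0 ≤ η)
    (hη : ∀ s, u s ≤ η) {t : ℝ} (ht : 0 ≤ t) (S : Finset ι) (hS : t ≤ ∑ s ∈ S, u s) :
    ∃ A ⊆ S, t - η ≤ ∑ s ∈ A, u s ∧ ∑ s ∈ A, u s ≤ t := by
  classical
  induction S using Finset.induction_on with
  | empty =>
    simp only [Finset.sum_empty] at hS
    exact ⟨∅, subset_rfl, by simp; linarith, by simpa using ht⟩
  | insert a S ha ih =>
    rw [Finset.sum_insert ha] at hS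
    by_cases h : t ≤ ∑ s ∈ S, u s
    · obtain ⟨A, hA, h1⟩ := ih h
      exact ⟨A, hA.trans (Finset.subset_insert _ _), h1⟩
    -- The element `a` is the one that carries the total across `t`, and it weighs at most `η`.
    · exact ⟨S, Finset.subset_insert _ _, by linarith [hη a], by linarith⟩

/-- Quantization: a random variable whose atoms have mass at most `η` has a function whose law is
at least `p - η` on `G`. -/
theorem exists_sum_fiber_ge {ι T : Type*} [DecidableEq T] [Nonempty T] {u : ι → ℝ} {p : T → ℝ}
    {η : ℝ} (hu0 : ∀ s, 0 ≤ u s) (hη0 : 0 ≤ η) (hη : ∀ s, u s ≤ η) (hp0 : ∀ x, 0 ≤ p x)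
    (G : Finset T) (S : Finset ι) (hS : ∑ x ∈ G, p x ≤ ∑ s ∈ S, u s) :
    ∃ φ : ι → T, ∀ x ∈ G, p x - η ≤ ∑ s ∈ S with φ s = x, u s := by
  classical
  induction G using Finset.induction_on generalizing S with
  | empty => exact ⟨fun _ => Classical.arbitrary T, by simp⟩
  | insert a G ha ih =>
    rw [Finset.sum_insert ha] at hS
    obtain ⟨A, hA, hlow, hup⟩ := exists_subset_sum_mem_Icc hη0 hη (hp0 a) S
      (by linarith [Finset.sum_nonneg fun x (_ : x ∈ G) => hp0 x])
    -- `A` uses at most `p a` of the mass, so enough remains for the other points.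
    obtain ⟨φ, hφ⟩ := ih (S \ A) (by linarith [Finset.sum_sdiff hA (f := u)])
    refine ⟨fun s => if s ∈ A then a else φ s, fun x hx => ?_⟩
    rcases Finset.mem_insert.mp hx with rfl | hxG
    · refine hlow.trans (Finset.sum_le_sum_of_subset_of_nonneg (fun s hs => ?_) fun s _ _ => hu0 s)
      simp [hA hs, hs]
    · refine (hφ x hxG).trans
        (Finset.sum_le_sum_of_subset_of_nonneg (fun s hs => ?_) fun s _ _ => hu0 s)
      simp only [Finset.mem_filter, Finset.mem_sdiff] at hs ⊢
      exact ⟨hs.1.1, by rw [if_neg hs.1.2, hs.2]⟩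

/-- A set with at least as many elements as `A` has a nearly balanced map to `A`. -/
theorem exists_balanced_map {A : Type*} [Fintype A] [DecidableEq A] [Nonempty A] {N : ℕ}
    (hN : Fintype.card A ≤ N) :
    ∃ f : Fin N → A, ∀ a, ((Finset.univ.filter fun w => f w = a).card : ℝ) ≤
      2 * N / Fintype.card A := by
  have hA : 0 < Fintype.card A := Fintype.card_pos
  -- Injectivity limits each fiber to `N / card A + 1` elements, at most `2 * N / card A` because
  -- `card A ≤ N`.
  obtain ⟨e⟩ : Nonempty (Fin N ↪ Fin (N / Fintype.card A + 1) × A) := by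
    apply Function.Embedding.nonempty_of_card_le
    rw [Fintype.card_fin, Fintype.card_prod, Fintype.card_fin, mul_comm]
    exact (Nat.lt_mul_div_succ N hA).le
  refine ⟨fun w => (e w).2, fun a => ?_⟩
  have h1 : (Finset.univ.filter fun w => (e w).2 = a).card ≤ N / Fintype.card A + 1 := by
    refine (Finset.card_le_card_of_injOn (t := Finset.univ) (fun w => (e w).1)
      (fun _ _ => Finset.mem_univ _) fun w hw w' hw' h => e.injective (Prod.ext h ?_)).trans_eq
      (Finset.card_fin _)
    simp only [Finset.coe_filter, Finset.mem_univ, true_and, Set.mem_ofPred_eq] at hw hw'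
    rw [hw, hw']
  have h2 : (N / Fintype.card A : ℕ) ≤ (N : ℝ) / Fintype.card A := Nat.cast_div_le
  have h3 : 1 ≤ (N : ℝ) / Fintype.card A := by
    rw [one_le_div (by exact_mod_cast hA)]
    exact_mod_cast hN
  have h4 : ((Finset.univ.filter fun w => (e w).2 = a).card : ℝ) ≤
      (N / Fintype.card A : ℕ) + 1 := by exact_mod_cast h1
  rw [mul_div_assoc]
  linarith

theorem sum_mul_card_fiber {ι A : Type*} [Fintype ι] [Fintype A] [DecidableEq A] (f : ι → A)
    (g : A → ℝ) : ∑ a, g a * (Finset.univ.filter fun w => f w = a).card = ∑ w, g (f w) := by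
  simp only [Finset.card_filter, Nat.cast_sum, Finset.mul_sum]
  rw [Finset.sum_comm]
  simp

/-- With equal totals, excess and deficit balance, so only the deficit of `p` below `q` needs
control. Off-diagonal mass of a code then costs nothing extra. -/
theorem tvDist_eq_sum_max {α : Type*} [Fintype α] {p q : α → ℝ} (h : ∑ a, p a = ∑ a, q a) :
    tvDist p q = ∑ a, max (q a - p a) 0 := by
  have h1 : ∀ a, (1 / 2) * |p a - q a| = max (q a - p a) 0 - (1 / 2) * (q a - p a) := by
    intro a
    rw [abs_sub_comm]
    rcases le_total (q a - p a) 0 with h | h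
    · rw [abs_of_nonpos h, max_eq_right h]
      ring
    · rw [abs_of_nonneg h, max_eq_left h]
      ring
  simp only [tvDist, h1, Finset.sum_sub_distrib, ← Finset.mul_sum, h]
  ring

theorem sum_eq_sum_diag {T : Type*} [Fintype T] {f : T × T → ℝ}
    (hf : ∀ x y, x ≠ y → f (x, y) = 0) : ∑ z, f z = ∑ x, f (x, x) := by
  rw [Fintype.sum_prod_type]
  exact Finset.sum_congr rfl fun x _ => Finset.sum_eq_single x (fun y _ h => hf x y h.symm)
    (fun h => absurd (Finset.mem_univ x) h)

namespace SimulationCode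

variable {𝒳 𝒴 : Type*} {n K K₁ K₂ : ℕ}

theorem induced_nonneg (c : SimulationCode 𝒳 𝒴 n K K₁ K₂) (z : (Fin n → 𝒳) × (Fin n → 𝒴)) :
    0 ≤ c.induced z :=
  Finset.sum_nonneg fun _ _ => Finset.sum_nonneg fun _ _ => Finset.sum_nonneg fun _ _ => by
    unfold joint
    positivity

theorem sum_induced [Fintype 𝒳] [Fintype 𝒴] (c : SimulationCode 𝒳 𝒴 n K K₁ K₂) (h₁ : 0 < K₁)
    (h₂ : 0 < K₂) : ∑ z, c.induced z = 1 := by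
  have h₁' : (K₁ : ℝ) ≠ 0 := by exact_mod_cast h₁.ne'
  have h₂' : (K₂ : ℝ) ≠ 0 := by exact_mod_cast h₂.ne'
  have inner : ∀ w₁ w₂, ∑ z : (Fin n → 𝒳) × (Fin n → 𝒴), ∑ m, c.joint w₁ w₂ m z.1 z.2 =
      1 / (K₁ * K₂) := by
    intro w₁ w₂
    rw [Finset.sum_comm]
    simp only [joint, Fintype.sum_prod_type, ← Finset.sum_div, ← Finset.mul_sum, sum_toReal_pmf,
      mul_one]
  simp only [induced]
  rw [Finset.sum_comm]
  simp only [Finset.sum_comm (s := (Finset.univ : Finset ((Fin n → 𝒳) × (Fin n → 𝒴))))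
    (t := (Finset.univ : Finset (Fin K₂))), inner]
  simp
  field_simp

/-- The code in which the shared randomness is mapped to the group `A`, the message is the sum of
the two group elements together with an independent uniform element of `E`, and both processors
evaluate `φ` at the two group elements and the element of `E`. -/
noncomputable def ofQuantizer {A E : Type*} [AddCommGroup A] [Fintype E] [Nonempty E]
    (emb : A × E ↪ Fin K) (a₁ : Fin K₁ → A) (a₂ : Fin K₂ → A) (φ : A × A × E → Fin n → 𝒳) :
    SimulationCode 𝒳 𝒳 n K K₁ K₂ where
  encoder w₁ w₂ := (PMF.uniformOfFintype E).map fun e => emb (a₁ w₁ + a₂ w₂, e)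
  decoder₁ m w₁ :=
    PMF.pure (φ (a₁ w₁, (Function.invFun emb m).1 - a₁ w₁, (Function.invFun emb m).2))
  decoder₂ m w₂ :=
    PMF.pure (φ ((Function.invFun emb m).1 - a₂ w₂, a₂ w₂, (Function.invFun emb m).2))

/-- Both processors invert `emb` and subtract their own group element, recovering the same triple.
The diagonal output is thus the image under `φ` of that triple's law. -/
theorem induced_ofQuantizer [DecidableEq 𝒳] {A E : Type*} [AddCommGroup A] [Fintype E]
    [Nonempty E]
    (emb : A × E ↪ Fin K) (a₁ : Fin K₁ → A) (a₂ : Fin K₂ → A) (φ : A × A × E → Fin n → 𝒳)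
    (x : Fin n → 𝒳) :
    (ofQuantizer emb a₁ a₂ φ).induced (x, x) = ∑ w₁ : Fin K₁, ∑ w₂ : Fin K₂, ∑ e : E,
      if φ (a₁ w₁, a₂ w₂, e) = x then (1 : ℝ) / (K₁ * K₂ * Fintype.card E) else 0 := by
  classical
  simp only [induced, joint, ofQuantizer]
  refine Finset.sum_congr rfl fun w₁ _ => Finset.sum_congr rfl fun w₂ _ => ?_
  have henc : ∀ m, (((PMF.uniformOfFintype E).map fun e => emb (a₁ w₁ + a₂ w₂, e)) m).toReal =
      ∑ e : E, if m = emb (a₁ w₁ + a₂ w₂, e) then (1 : ℝ) / Fintype.card E else 0 := by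
    intro m
    rw [PMF.map_apply, tsum_fintype, ENNReal.toReal_sum (by intro a _; split_ifs <;> simp)]
    refine Finset.sum_congr rfl fun e _ => ?_
    split_ifs <;> simp
  simp only [henc, Finset.sum_mul, Finset.sum_div]
  rw [Finset.sum_comm]
  refine Finset.sum_congr rfl fun e _ => ?_
  rw [Finset.sum_eq_single (emb (a₁ w₁ + a₂ w₂, e)) (fun m _ hm => by simp [hm]) (by simp)]
  simp only [Function.leftInverse_invFun emb.injective (a₁ w₁ + a₂ w₂, e), if_true,
    add_sub_cancel_left, add_sub_cancel_right, PMF.pure_apply, eq_comm (a := x)]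
  split_ifs <;> simp
  field_simp

end SimulationCode

open Classical in
/-- One-shot simulation of a law carried by the diagonal. -/
theorem exists_code_tvDist_le {𝒳 : Type*} [Fintype 𝒳] [Nonempty 𝒳] {n K K₁ K₂ k l : ℕ}
    (hk : 0 < k) (hl : 0 < l) (hK : k * l ≤ K) (hK₁ : k ≤ K₁) (hK₂ : k ≤ K₂)
    {q : (Fin n → 𝒳) × (Fin n → 𝒳) → ℝ} (hq0 : ∀ z, 0 ≤ q z)
    (hqd : ∀ x y, x ≠ y → q (x, y) = 0) (hq : ∑ x, q (x, x) = 1) (G : Finset (Fin n → 𝒳)) :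
    ∃ c : SimulationCode 𝒳 𝒳 n K K₁ K₂,
      tvDist c.induced q ≤ G.card * (4 / (k * k * l)) + ∑ x with x ∉ G, q (x, x) := by
  have : NeZero k := ⟨hk.ne'⟩
  have : NeZero l := ⟨hl.ne'⟩
  have hK₁' : (0 : ℝ) < K₁ := by exact_mod_cast hk.trans_le hK₁
  have hK₂' : (0 : ℝ) < K₂ := by exact_mod_cast hk.trans_le hK₂
  have hk' : (0 : ℝ) < k := by exact_mod_cast hk
  have hl' : (0 : ℝ) < l := by exact_mod_cast hl
  obtain ⟨emb⟩ : Nonempty (ZMod k × Fin l ↪ Fin K) := by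
    apply Function.Embedding.nonempty_of_card_le
    simpa [ZMod.card] using hK
  obtain ⟨a₁, ha₁⟩ := exists_balanced_map (A := ZMod k) (N := K₁) (by rwa [ZMod.card])
  obtain ⟨a₂, ha₂⟩ := exists_balanced_map (A := ZMod k) (N := K₂) (by rwa [ZMod.card])
  rw [ZMod.card] at ha₁ ha₂
  -- The law of the common triple. Each balanced map contributes a factor at most `2 / k`, whence
  -- the atom bound `4 / (k * k * l)`.
  set u : ZMod k × ZMod k × Fin l → ℝ := fun s =>
    ((Finset.univ.filter fun w => a₁ w = s.1).card / K₁) *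
      ((Finset.univ.filter fun w => a₂ w = s.2.1).card / K₂) * (1 / l) with hu
  have hu0 : ∀ s, 0 ≤ u s := fun s => by positivity
  have hη : ∀ s, u s ≤ 4 / (k * k * l) := by
    intro s
    have h₁ : ((Finset.univ.filter fun w => a₁ w = s.1).card : ℝ) / K₁ ≤ 2 / k := by
      rw [div_le_iff₀ hK₁']
      exact (ha₁ s.1).trans_eq (by ring)
    have h₂ : ((Finset.univ.filter fun w => a₂ w = s.2.1).card : ℝ) / K₂ ≤ 2 / k := by
      rw [div_le_iff₀ hK₂']
      exact (ha₂ s.2.1).trans_eq (by ring)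
    calc u s ≤ 2 / k * (2 / k) * (1 / l) := by
          simp only [hu]
          gcongr
      _ = 4 / (k * k * l) := by
          field_simp
          norm_num
  have push : ∀ f : ZMod k × ZMod k × Fin l → ℝ, ∑ s, f s * u s =
      ∑ w₁ : Fin K₁, ∑ w₂ : Fin K₂, ∑ e : Fin l,
        f (a₁ w₁, a₂ w₂, e) * (1 / (K₁ * K₂ * l)) := by
    intro f
    rw [← sum_mul_card_fiber a₁ fun a => ∑ w₂ : Fin K₂, ∑ e : Fin l,
      f (a, a₂ w₂, e) * (1 / (K₁ * K₂ * l)), Fintype.sum_prod_type]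
    refine Finset.sum_congr rfl fun a _ => ?_
    rw [← sum_mul_card_fiber a₂ fun b => ∑ e : Fin l, f (a, b, e) * (1 / (K₁ * K₂ * l)),
      Fintype.sum_prod_type, Finset.sum_mul]
    refine Finset.sum_congr rfl fun b _ => ?_
    rw [Finset.sum_mul, Finset.sum_mul]
    refine Finset.sum_congr rfl fun e _ => ?_
    simp only [hu]
    field_simp
  have hsum : ∑ s, u s = 1 := by
    have := push fun _ => 1
    simp only [one_mul] at this
    rw [this]
    simp
    field_simp
  obtain ⟨φ, hφ⟩ := exists_sum_fiber_ge (T := Fin n → 𝒳) (p := fun x => q (x, x)) hu0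
    (by positivity) hη (fun x => hq0 _) G Finset.univ (by
      rw [hsum, ← hq]
      exact Finset.sum_le_univ_sum_of_nonneg fun x => hq0 _)
  refine ⟨SimulationCode.ofQuantizer emb a₁ a₂ φ, ?_⟩
  set c := SimulationCode.ofQuantizer emb a₁ a₂ φ with hc
  have hind : ∀ x ∈ G, q (x, x) - 4 / (k * k * l) ≤ c.induced (x, x) := by
    intro x hx
    refine (hφ x hx).trans_eq ?_
    rw [hc, SimulationCode.induced_ofQuantizer, Finset.sum_filter]
    have := push fun s => if φ s = x then 1 else 0
    simpa only [ite_mul, one_mul, zero_mul, Fintype.card_fin] using this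
  have htot : ∑ z, c.induced z = ∑ z, q z := by
    rw [c.sum_induced (hk.trans_le hK₁) (hk.trans_le hK₂), sum_eq_sum_diag hqd, hq]
  rw [tvDist_eq_sum_max htot, sum_eq_sum_diag fun x y hxy => by
    rw [hqd x y hxy]
    exact max_eq_right (by linarith [c.induced_nonneg (x, y)])]
  rw [← Finset.sum_filter_add_sum_filter_not Finset.univ (fun x => x ∈ G)]
  refine add_le_add ?_ (Finset.sum_le_sum fun x _ => max_le ?_ (hq0 _))
  · rw [Finset.filter_univ_mem, ← nsmul_eq_mul]
    exact Finset.sum_le_card_nsmul _ _ _ fun x hx =>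
      max_le (by linarith [hind x hx]) (by positivity)
  · linarith [c.induced_nonneg (x, x)]

-- The error is the number of typical sequences, at most `2^(n(H + δ))`, times the atom bound of
-- order `2^(-n(R + r))`, plus the atypical mass.
open Filter Topology in
theorem achievable_of_lt {𝒳 : Type*} [Fintype 𝒳] {q : PMF (𝒳 × 𝒳)} {p : 𝒳 → ℝ}
    (hqd : ∀ a b, a ≠ b → q (a, b) = 0) (hpq : ∀ a, (q (a, a)).toReal = p a)
    (hp : ∑ a, p a = 1) {R R₁ R₂ : ℝ} (hR : 0 ≤ R) (hR₁ : 0 ≤ R₁) (hR₂ : 0 ≤ R₂)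
    (h : massEntropy p < R + min R (min R₁ R₂)) : Achievable q R R₁ R₂ := by
  refine ⟨hR, hR₁, hR₂, ?_⟩
  have hp0 : ∀ a, 0 ≤ p a := fun a => hpq a ▸ ENNReal.toReal_nonneg
  have : Nonempty 𝒳 := by
    by_contra hne
    rw [not_nonempty_iff] at hne
    simp at hp
  -- The group must fit into the message set and into both seeds.
  set r := min R (min R₁ R₂) with hr
  have hr0 : 0 ≤ r := le_min hR (le_min hR₁ hR₂)
  set δ := (R + r - massEntropy p) / 2 with hδ
  have hδ0 : 0 < δ := by linarith
  -- The constant 32 is the 4 of the atom bound times the 8 lost to rounding below.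
  have step : ∀ n : ℕ, ∃ c : SimulationCode 𝒳 𝒳 n (numIndices n R) (numIndices n R₁)
      (numIndices n R₂), tvDist c.induced (iidPmf q n) ≤ 32 * 2 ^ (n * (-δ)) +
        ∑ x : Fin n → 𝒳 with ∏ i, p (x i) < (2 : ℝ) ^ (-(n * (massEntropy p + δ))),
          ∏ i, p (x i) := by
    intro n
    have hk := numIndices_pos n hr0
    have hkK : numIndices n r ≤ numIndices n R := numIndices_mono n (min_le_left _ _)
    set G : Finset (Fin n → 𝒳) := Finset.univ.filter fun x =>
      (2 : ℝ) ^ (-(n * (massEntropy p + δ))) ≤ ∏ i, p (x i) with hG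
    obtain ⟨c, hc⟩ := exists_code_tvDist_le (q := iidPmf q n) hk (Nat.div_pos hkK hk)
      (Nat.mul_div_le (numIndices n R) (numIndices n r))
      (numIndices_mono n ((min_le_right _ _).trans (min_le_left _ _)) : _ ≤ numIndices n R₁)
      (numIndices_mono n ((min_le_right _ _).trans (min_le_right _ _)) : _ ≤ numIndices n R₂)
      (fun z => Finset.prod_nonneg fun i _ => ENNReal.toReal_nonneg)
      (fun x y hxy => by
        obtain ⟨i, hi⟩ := Function.ne_iff.mp hxy
        exact Finset.prod_eq_zero (Finset.mem_univ i) (by simp [hqd _ _ hi]))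
      (by simpa only [iidPmf, hpq] using sum_prod_eq_one hp n) G
    refine ⟨c, hc.trans (add_le_add ?_ (le_of_eq ?_))⟩
    · have hcard : (G.card : ℝ) ≤ 2 ^ (n * (massEntropy p + δ)) := by
        have h1 : G.card • (2 : ℝ) ^ (-(n * (massEntropy p + δ))) ≤ ∑ x ∈ G, ∏ i, p (x i) :=
          Finset.card_nsmul_le_sum _ _ _ fun x hx => (Finset.mem_filter.mp hx).2
        have h2 := h1.trans (Finset.sum_le_univ_sum_of_nonneg fun x =>
          Finset.prod_nonneg fun i _ => hp0 (x i))
        rw [sum_prod_eq_one hp, nsmul_eq_mul, Real.rpow_neg zero_le_two, ← div_eq_mul_inv,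
          div_le_one (by positivity)] at h2
        exact h2
      -- With `k = numIndices n r`, `K = numIndices n R` and `l = K / k ≥ 1`, a factor 2 is lost in
      -- each of `k ≥ 2^(nr) / 2`, `K ≥ 2^(nR) / 2` and `k * l ≥ K / 2`.
      have hden : (2 : ℝ) ^ (n * (R + r)) / 8 ≤
          numIndices n r * numIndices n r * (numIndices n R / numIndices n r : ℕ) := by
        have h1 := half_two_rpow_le_numIndices n hr0
        have h2 := half_two_rpow_le_numIndices n hR
        have h3 : (numIndices n R : ℝ) / 2 ≤
            numIndices n r * (numIndices n R / numIndices n r : ℕ) := by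
          have h4 : numIndices n R < numIndices n r * (numIndices n R / numIndices n r + 1) :=
            Nat.lt_mul_div_succ _ hk
          have h5 : numIndices n r * 1 ≤ numIndices n r * (numIndices n R / numIndices n r) :=
            Nat.mul_le_mul_left _ (Nat.div_pos hkK hk)
          have h6 : numIndices n R ≤ 2 * (numIndices n r * (numIndices n R / numIndices n r)) := by
            linarith
          have h7 : (numIndices n R : ℝ) ≤
              2 * (numIndices n r * (numIndices n R / numIndices n r : ℕ)) := by
            exact_mod_cast h6
          linarith
        calc (2 : ℝ) ^ (n * (R + r)) / 8 = 2 ^ (n * r) / 2 * (2 ^ (n * R) / 2 / 2) := by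
              rw [mul_add, Real.rpow_add two_pos]
              ring
          _ ≤ numIndices n r * (numIndices n r * (numIndices n R / numIndices n r : ℕ)) :=
              mul_le_mul h1 (le_trans (by linarith) h3) (by positivity) (by positivity)
          _ = _ := by ring
      calc (G.card : ℝ) * (4 / (numIndices n r * numIndices n r *
            (numIndices n R / numIndices n r : ℕ)))
          ≤ 2 ^ (n * (massEntropy p + δ)) * (4 / (2 ^ (n * (R + r)) / 8)) := by gcongr
        _ = 32 * (2 ^ (n * (massEntropy p + δ)) / 2 ^ (n * (R + r))) := by
            field_simp
            norm_num
        _ = 32 * 2 ^ (n * (-δ)) := by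
            rw [← Real.rpow_sub two_pos]
            congr 2
            rw [hδ]
            ring
    · simp only [hG, Finset.mem_filter, Finset.mem_univ, true_and, not_le, iidPmf, hpq]
  choose c hc using step
  refine ⟨c, squeeze_zero (fun n => Finset.sum_nonneg fun z _ => by positivity) hc ?_⟩
  simpa using ((tendsto_two_rpow_mul (neg_lt_zero.mpr hδ0)).const_mul 32).add
    (tendsto_sum_prod_of_small hp0 hp hδ0)

end CoordSim

/-! ### The simulation rate region -/

theorem theorem4 {𝒳 : Type*} [Fintype 𝒳] [MeasurableSpace 𝒳] [MeasurableSingletonClass 𝒳]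
    {Ω : Type*} [MeasurableSpace Ω] (P : MeasureTheory.Measure Ω)
    [MeasureTheory.IsProbabilityMeasure P]
    (q : PMF (𝒳 × 𝒳)) (X Y : Ω → 𝒳)
    (hlaw : ProbabilityTheory.HasLaw (fun ω => (X ω, Y ω)) q.toMeasure P)
    (hXY : ∀ᵐ ω ∂P, X ω = Y ω) :
    CoordSim.simulationRateRegion q =
      {r : ℝ × ℝ × ℝ | 0 ≤ r.1 ∧ 0 ≤ r.2.1 ∧ 0 ≤ r.2.2 ∧
        CoordSim.entropy X P ≤ r.1 + min r.2.1 r.2.2 ∧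
        CoordSim.entropy X P / 2 ≤ r.1} := by
  have hmass : ∀ a b, P ((fun ω => (X ω, Y ω)) ⁻¹' {(a, b)}) = q (a, b) := fun a b => by
    rw [← MeasureTheory.Measure.map_apply_of_aemeasurable hlaw.aemeasurable
      (measurableSet_singleton _), hlaw.map_eq,
      PMF.toMeasure_apply_singleton _ _ (measurableSet_singleton _)]
  have hqd : ∀ a b, a ≠ b → q (a, b) = 0 := by
    intro a b hab
    rw [← hmass]
    refine MeasureTheory.measure_mono_null (fun ω hω => ?_) (MeasureTheory.ae_iff.mp hXY)
    obtain ⟨rfl, rfl⟩ := Prod.mk.inj hω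
    exact hab
  have hpq : ∀ a, (q (a, a)).toReal = P.real (X ⁻¹' {a}) := by
    intro a
    rw [← hmass, MeasureTheory.measureReal_def]
    congr 1
    refine MeasureTheory.measure_congr ?_
    filter_upwards [hXY] with ω hω
    refine propext ?_
    change (X ω, Y ω) = (a, a) ↔ X ω = a
    simp [← hω]
  have hp : ∑ a, P.real (X ⁻¹' {a}) = 1 := by
    simp only [← hpq]
    rw [← CoordSim.sum_toReal_pmf q, CoordSim.sum_eq_sum_diag fun a b hab => by simp [hqd a b hab]]
  have hH : CoordSim.entropy X P = CoordSim.massEntropy fun a => P.real (X ⁻¹' {a}) := rfl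
  rw [hH]
  set H := CoordSim.massEntropy fun a => P.real (X ⁻¹' {a})
  apply Set.Subset.antisymm
  · refine closure_minimal ?_ ?_
    · rintro ⟨R, R₁, R₂⟩ hr
      obtain ⟨h0, h1, h2⟩ := hr.massEntropy_le hpq hp
      refine ⟨hr.1, hr.2.1, hr.2.2.1, ?_, ?_⟩
      · rw [← min_add_add_left]
        exact le_min h1 h2
      · change H / 2 ≤ R
        linarith
    · simp only [Set.ofPred_and]
      refine IsClosed.inter ?_ (IsClosed.inter ?_ (IsClosed.inter ?_ (IsClosed.inter ?_ ?_))) <;>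
      exact isClosed_le (by fun_prop) (by fun_prop)
  · rintro ⟨R, R₁, R₂⟩ ⟨hR, hR₁, hR₂, h1, h2⟩
    simp only at hR hR₁ hR₂ h1 h2
    -- Raising `R` alone makes `2R`, `R + R₁` and `R + R₂` all exceed `H` strictly.
    have lim : Filter.Tendsto (fun ε : ℝ => (R + ε, R₁, R₂)) (nhdsWithin 0 (Set.Ioi 0))
        (nhds (R, R₁, R₂)) := by
      refine Filter.Tendsto.mono_left ?_ nhdsWithin_le_nhds
      exact Continuous.tendsto' (by fun_prop) _ _ (by simp)
    refine mem_closure_of_tendsto lim ?_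
    filter_upwards [self_mem_nhdsWithin] with ε hε
    have hε' : 0 < ε := hε
    refine CoordSim.achievable_of_lt hqd hpq hp (by linarith) hR₁ hR₂ ?_
    rw [← min_add_add_left]
    exact lt_min (by linarith) (by linarith)
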